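/- For $d\in\mathbb N$ let $M_d$ be the algebra of complex $d\times d$ matrices, and for an $m\times n$ complex matrix $V$ let $\mathrm{Ad}_V:M_m\to M_n$ be the map $\mathrm{Ad}_V(X)=V^*XV$. Let $d_1,d_2\in\mathbb N$ and let $\mathrm{UCP}(d_1,d_2)$ be the set of unital completely positive linear maps $M_{d_1}\to M_{d_2}$. A map $\Phi\in\mathrm{UCP}(d_1,d_2)$ is a $C^*$-extreme point of $\mathrm{UCP}(d_1,d_2)$ if, whenever $\Phi=\sum_{i=1}^n\mathrm{Ad}_{T_i}\circ\Phi_i$ with $\Phi_i\in\mathrm{UCP}(d_1,d_2)$ and invertible $T_i\in M_{d_2}$ satisfying $\sum_{i=1}^nT_i^*T_i=I_{d_2}$, there are unitaries $U_i\in M_{d_2}$ with $\Phi_i=\mathrm{Ad}_{U_i}\circ\Phi$ for all $1\le i\le n$. **Corollary.** Every $C^*$-extreme point $\Phi$ of $\mathrm{UCP}(d_1,d_2)$ is degradable; that is, there exist $k\in\mathbb N$, a completely positive linear map $\Gamma:M_{d_2}\to M_k$ and a linear operator $A:\mathbb C^{d_1}\to\mathbb C^{d_2}\otimes\mathbb C^k$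 such that, for all $T\in M_{d_1}$, $$\Phi(T)=(\mathrm{id}\otimes\mathrm{tr})(ATA^*)\qquad\text{and}\qquad \Gamma(\Phi(T))=(\mathrm{tr}\otimes\mathrm{id})(ATA^*),$$ i.e. $\Gamma\circ\Phi$ is complementary to $\Phi$. -/

import Mathlib

/-- The algebra `M_d` of complex `d × d` matrices. -/
abbrev Mat (d : ℕ) : Type := Matrix (Fin d) (Fin d) ℂ

section CompletelyPositive

open scoped Matrix.Norms.L2Operator MatrixOrder ComplexOrder CStarAlgebra

/-- A linear map `M_{d₁} → M_{d₂}` is completely positive: it underlies a completely positive map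
between the C⋆-algebras `M_{d₁}` and `M_{d₂}` (operator norm, Loewner order). -/
def IsCompletelyPositive {d₁ d₂ : ℕ} (Φ : Mat d₁ →ₗ[ℂ] Mat d₂) : Prop :=
  ∃ Θ : Mat d₁ →CP Mat d₂, Θ.toLinearMap = Φ

end CompletelyPositive

section Channels

open scoped Matrix

/-- `UCP(d₁, d₂)`: the set of unital completely positive maps `M_{d₁} → M_{d₂}`. -/
def UCP (d₁ d₂ : ℕ) : Set (Mat d₁ →ₗ[ℂ] Mat d₂) :=
  {Φ | IsCompletelyPositive Φ ∧ Φ 1 = 1}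

/-- The map `Ad_V : M_m → M_n`, `X ↦ V* X V`, for an `m × n` matrix `V`. -/
def adMap {m n : ℕ} (V : Matrix (Fin m) (Fin n) ℂ) : Mat m →ₗ[ℂ] Mat n where
  toFun X := Vᴴ * X * V
  map_add' X Y := by rw [Matrix.mul_add, Matrix.add_mul]
  map_smul' c X := by simp

/-- `Φ` is a C⋆-extreme point of the set `S` of linear maps `M_{d₁} → M_{d₂}`: it lies in `S`, and
whenever `Φ = ∑ Ad_{T i} ∘ Ψ i` with `T i` invertible, `∑ (T i)* (T i) = 1` and `Ψ i ∈ S`, every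
`Ψ i` is unitarily equivalent to `Φ`. -/
def IsCStarExtremePoint {d₁ d₂ : ℕ} (S : Set (Mat d₁ →ₗ[ℂ] Mat d₂))
    (Φ : Mat d₁ →ₗ[ℂ] Mat d₂) : Prop :=
  Φ ∈ S ∧
    ∀ (n : ℕ) (T : Fin n → Mat d₂) (Ψ : Fin n → (Mat d₁ →ₗ[ℂ] Mat d₂)),
      (∀ i, IsUnit (T i)) → (∑ i, (T i)ᴴ * T i = 1) → (∀ i, Ψ i ∈ S) →
      Φ = ∑ i, adMap (T i) ∘ₗ Ψ i →
      ∀ i, ∃ U ∈ Matrix.unitaryGroup (Fin d₂) ℂ, Ψ i = adMap U ∘ₗ Φ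

/-- Partial trace over the second factor of `ℂ^m ⊗ ℂ^k`. -/
def partialTraceSnd {m k : ℕ} (M : Matrix (Fin m × Fin k) (Fin m × Fin k) ℂ) : Mat m :=
  Matrix.of fun i j => ∑ l, M (i, l) (j, l)

/-- Partial trace over the first factor of `ℂ^m ⊗ ℂ^k`. -/
def partialTraceFst {m k : ℕ} (M : Matrix (Fin m × Fin k) (Fin m × Fin k) ℂ) : Mat k :=
  Matrix.of fun i j => ∑ l, M (l, i) (l, j)

/-- `Ψ : M_{d₁} → M_{d₃}` is complementary to `Φ : M_{d₁} → M_{d₂}`: for some linear operator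
`A : ℂ^{d₁} → ℂ^{d₂} ⊗ ℂ^{d₃}`, `Φ(T)` and `Ψ(T)` are the two partial traces of `A T A*`.
(Both maps are then automatically completely positive.) -/
def IsComplementary {d₁ d₂ d₃ : ℕ} (Φ : Mat d₁ →ₗ[ℂ] Mat d₂) (Ψ : Mat d₁ →ₗ[ℂ] Mat d₃) : Prop :=
  ∃ A : Matrix (Fin d₂ × Fin d₃) (Fin d₁) ℂ,
    ∀ T : Mat d₁, Φ T = partialTraceSnd (A * T * Aᴴ) ∧ Ψ T = partialTraceFst (A * T * Aᴴ)

/-- `Φ` is degradable: some completely positive `Γ : M_{d₂} → M_k` makes `Γ ∘ Φ` complementary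
to `Φ`. -/
def IsDegradable {d₁ d₂ : ℕ} (Φ : Mat d₁ →ₗ[ℂ] Mat d₂) : Prop :=
  ∃ (k : ℕ) (Γ : Mat d₂ →ₗ[ℂ] Mat k), IsCompletelyPositive Γ ∧ IsComplementary Φ (Γ ∘ₗ Φ)

end Channels

/-! ### Operator algebras in which every projection factors -/

section ProjectionFactorization

open InnerProductSpace

variable {E : Type*} [NormedAddCommGroup E] [InnerProductSpace ℂ E] [FiniteDimensional ℂ E]

/-! Write `Φ` with linearly independent Kraus operators `V l`, and let `𝒜` be the algebra of
coefficient matrices `C` with `C V = V S` for some `S` (`krausAlgebra`). If `D = x* x` and `1 - D =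
y* y` are positive definite, the mixtures `x V` and `y V` split `Φ` into two normalizable pieces.
C⋆-extremality turns `x V` into `V S` up to a change of Kraus operators, so `D = C* C` with `C ∈ 𝒜`
(`exists_mem_krausAlgebra_factorization`). By compactness every projection factors in this way.

Such an algebra contains the diagonal projections of some orthonormal basis
(`exists_orthonormalBasis_rankOne_mem`). Kraus operators `W i` expanded in that basis satisfy `W j
(W i)* = 0` for `j ≠ i`. By unitality the `(W i)* W i` are then projections which cut `Φ(T)` down to
`(W i)* T (W i)`. The traces of these corners are the diagonal of the complementary map, whose
off-diagonal entries vanish (`isDegradable_krausMap`). -/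

theorem starProjection_sup_of_le_orthogonal {N M : Submodule ℂ E} (h : M ≤ Nᗮ) :
    (N ⊔ M).starProjection = N.starProjection + M.starProjection := by
  ext x
  apply Submodule.eq_starProjection_of_mem_orthogonal
  · exact Submodule.add_mem_sup (Submodule.starProjection_apply_mem _ _)
      (Submodule.starProjection_apply_mem _ _)
  · rw [Submodule.mem_orthogonal']
    intro y hy
    obtain ⟨n, hn, m, hm, rfl⟩ := Submodule.mem_sup.mp hy
    have h1 : inner ℂ (x - N.starProjection x) n = 0 :=
      Submodule.inner_left_of_mem_orthogonal hn (Submodule.sub_starProjection_mem_orthogonal x)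
    have h2 : inner ℂ (x - M.starProjection x) m = 0 :=
      Submodule.inner_left_of_mem_orthogonal hm (Submodule.sub_starProjection_mem_orthogonal x)
    have h3 : inner ℂ (N.starProjection x) m = 0 :=
      Submodule.inner_right_of_mem_orthogonal (Submodule.starProjection_apply_mem _ _) (h hm)
    have h4 : inner ℂ (M.starProjection x) n = 0 :=
      Submodule.inner_left_of_mem_orthogonal hn (h (Submodule.starProjection_apply_mem _ _))
    rw [inner_sub_left] at h1 h2
    simp only [add_apply, inner_sub_left, inner_add_left, inner_add_right]
    linear_combination h1 + h2 - h3 - h4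

/-- If the projection onto `N ⊕ ℂ f` factors as `C* C` with `C` leaving `N` invariant, then `C` is
block diagonal, and cutting it down to the complement of `N` leaves a rank one operator. -/
theorem exists_rankOne_eq_of_factorization {N : Submodule ℂ E} {f : E} (hf : f ∈ Nᗮ)
    (hf1 : ‖f‖ = 1) {C : E →L[ℂ] E} (hC : star C * C = N.starProjection + rankOne ℂ f f)
    (hN : ∀ x ∈ N, C x ∈ N) :
    C f ∈ Nᗮ ∧ C f ≠ 0 ∧ C * (1 - N.starProjection) = rankOne ℂ (C f) f := by
  have key (x y : E) : inner ℂ (C x) (C y) = inner ℂ x (N.starProjection y + inner ℂ f y • f) := by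
    have := congrArg (fun T : E →L[ℂ] E => inner ℂ x (T y)) hC
    simpa [ContinuousLinearMap.star_eq_adjoint, ContinuousLinearMap.adjoint_inner_right] using this
  have hff : inner ℂ f f = (1 : ℂ) := by simp [inner_self_eq_norm_sq_to_K, hf1]
  have hPf : N.starProjection f = 0 := (Submodule.starProjection_apply_eq_zero_iff N).2 hf
  -- `C` is isometric on `N`, so in finite dimension it maps `N` onto `N`; `C f`, orthogonal to `C
  -- N`, is then orthogonal to `N`.
  have hinj : Function.Injective ((C : E →ₗ[ℂ] E).restrict hN) := by
    rw [← LinearMap.ker_eq_bot, LinearMap.ker_eq_bot']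
    intro x hx
    have hx' : C x = 0 := by simpa using congrArg Subtype.val hx
    have := key x x
    rw [hx', Submodule.starProjection_eq_self_iff.2 x.2,
      Submodule.inner_left_of_mem_orthogonal x.2 hf] at this
    simpa using this.symm
  have hsurj := LinearMap.injective_iff_surjective.1 hinj
  refine ⟨?_, ?_, ?_⟩
  · rw [Submodule.mem_orthogonal]
    intro u hu
    obtain ⟨x, hx⟩ := hsurj ⟨u, hu⟩
    have hx' : C x = u := by simpa using congrArg Subtype.val hx
    rw [← hx', key, hPf, hff]
    simpa using Submodule.inner_right_of_mem_orthogonal x.2 hf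
  · intro h0
    have := key f f
    rw [hPf, zero_add, hff, one_smul, hff, h0, inner_zero_left] at this
    exact zero_ne_one this
  · ext y
    set z := y - N.starProjection y - inner ℂ f y • f with hz
    have hzN : z ∈ Nᗮ := Submodule.sub_mem _ (Submodule.sub_starProjection_mem_orthogonal y)
      (Submodule.smul_mem _ _ hf)
    have hfz : inner ℂ f z = 0 := by
      have : inner ℂ f (N.starProjection y) = 0 :=
        Submodule.inner_left_of_mem_orthogonal (Submodule.starProjection_apply_mem _ _) hf
      rw [hz, inner_sub_right, inner_sub_right, inner_smul_right, hff, this]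
      ring
    have hCz : C z = 0 := by
      have := key z z
      rw [(Submodule.starProjection_apply_eq_zero_iff N).2 hzN, hfz] at this
      simpa using this
    have : y - N.starProjection y = z + inner ℂ f y • f := by rw [hz]; abel
    change C (y - N.starProjection y) = inner ℂ f y • C f
    rw [this, map_add, hCz, map_smul, zero_add]

theorem isStarProjection_starProjection_add_rankOne {N : Submodule ℂ E} {f : E} (hf : f ∈ Nᗮ)
    (hf1 : ‖f‖ = 1) : IsStarProjection (N.starProjection + rankOne ℂ f f) := by
  refine (isStarProjection_starProjection).add (isStarProjection_rankOne_self hf1) ?_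
  ext y
  simp [(Submodule.starProjection_apply_eq_zero_iff N).2 hf]

variable {𝒜 : Subalgebra ℂ (E →L[ℂ] E)}

/-- One step of a triangularization: above a proper invariant subspace `N` with projection in `𝒜`
there is a larger invariant subspace `N ⊔ M` such that `𝒜` contains all operators
`rankOne f f` with `f ∈ M` a unit vector. -/
theorem exists_invariant_extension
    (h𝒜 : ∀ p : E →L[ℂ] E, IsStarProjection p → ∃ C ∈ 𝒜, star C * C = p)
    {N : Submodule ℂ E} (hN : ∀ C ∈ 𝒜, ∀ x ∈ N, C x ∈ N) (hP : N.starProjection ∈ 𝒜)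
    (hne : N ≠ ⊤) :
    ∃ M : Submodule ℂ E, M ≤ Nᗮ ∧ M ≠ ⊥ ∧ (∀ C ∈ 𝒜, ∀ x ∈ N ⊔ M, C x ∈ N ⊔ M) ∧
      ∀ f ∈ M, ‖f‖ = 1 → rankOne ℂ f f ∈ 𝒜 := by
  set Q : E →L[ℂ] E := 1 - N.starProjection with hQ
  have hQ𝒜 : Q ∈ 𝒜 := sub_mem (one_mem _) hP
  have hQapp (x : E) : Q x = x - N.starProjection x := rfl
  have hQmem (x : E) : Q x ∈ Nᗮ := Submodule.sub_starProjection_mem_orthogonal x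
  have hQid {x : E} (hx : x ∈ Nᗮ) : Q x = x := by
    rw [hQapp, (Submodule.starProjection_apply_eq_zero_iff N).2 hx, sub_zero]
  -- A minimal nonzero subspace invariant under the compressions of `𝒜` to `Nᗮ` will be `M`.
  let S : Set (Submodule ℂ E) :=
    {M | M ≤ Nᗮ ∧ M ≠ ⊥ ∧ ∀ C ∈ 𝒜, ∀ x ∈ M, Q (C x) ∈ M}
  have hS : S.Nonempty := ⟨Nᗮ, le_rfl, fun h => hne ((Submodule.orthogonal_eq_bot_iff).1 h),
    fun C _ x _ => hQmem _⟩
  obtain ⟨M, ⟨hMN, hM0, hMinv⟩, hmin⟩ :=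
    (wellFounded_lt (α := Submodule ℂ E)).has_min S hS
  refine ⟨M, hMN, hM0, ?_, ?_⟩
  · intro C hC x hx
    obtain ⟨n, hn, m, hm, rfl⟩ := Submodule.mem_sup.mp hx
    have : C (n + m) = (C n + N.starProjection (C m)) + Q (C m) := by
      rw [hQapp, map_add]; abel
    rw [this]
    exact Submodule.add_mem_sup (N.add_mem (hN C hC n hn) (Submodule.starProjection_apply_mem _ _))
      (hMinv C hC m hm)
  · intro f hf hf1
    obtain ⟨C, hC, hCp⟩ := h𝒜 _ (isStarProjection_starProjection_add_rankOne (hMN hf) hf1)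
    obtain ⟨hg, hg0, hgf⟩ := exists_rankOne_eq_of_factorization (hMN hf) hf1 hCp (hN C hC)
    have hgM : C f ∈ M := by simpa [hQid hg] using hMinv C hC f hf
    -- `L` is compression-invariant and contains `C f ≠ 0`, so minimality gives `L = M`, and hence
    -- `f ∈ L`.
    let L : Submodule ℂ E :=
      { carrier := {x | x ∈ M ∧ rankOne ℂ x f ∈ 𝒜}
        add_mem' := fun {a b} ha hb => ⟨M.add_mem ha.1 hb.1, by
          simpa using add_mem ha.2 hb.2⟩
        zero_mem' := ⟨M.zero_mem, by simp⟩
        smul_mem' := fun c x hx => ⟨M.smul_mem c hx.1, by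
          simpa using 𝒜.smul_mem hx.2 c⟩ }
    have hLM : L ≤ M := fun x hx => hx.1
    have hLS : L ∈ S := by
      refine ⟨hLM.trans hMN, ?_, ?_⟩
      · intro h
        have : C f ∈ L := ⟨hgM, by rw [← hgf]; exact mul_mem hC hQ𝒜⟩
        rw [h] at this
        exact hg0 ((Submodule.mem_bot ℂ).1 this)
      · intro B hB x hx
        refine ⟨hMinv B hB x hx.1, ?_⟩
        have := mul_mem hQ𝒜 (mul_mem hB hx.2)
        rwa [ContinuousLinearMap.mul_def, ContinuousLinearMap.mul_def, comp_rankOne,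
          comp_rankOne] at this
    have hML : M ≤ L := by
      by_contra h
      exact hmin L hLS (lt_of_le_not_ge hLM h)
    exact (hML hf).2

/-- An operator algebra on a finite-dimensional Hilbert space in which every projection factors as
`C* C` contains the diagonal operators with respect to some orthonormal basis. -/
theorem exists_orthonormalBasis_rankOne_mem
    (h𝒜 : ∀ p : E →L[ℂ] E, IsStarProjection p → ∃ C ∈ 𝒜, star C * C = p) :
    ∃ (n : ℕ) (b : OrthonormalBasis (Fin n) ℂ E), ∀ i, rankOne ℂ (b i) (b i) ∈ 𝒜 := by
  classical
  -- Invariant subspaces spanned by an orthonormal set `s` whose rank one projections lie in `𝒜`. A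
  -- maximal one must be everything, since otherwise `s` grows by an orthonormal basis of the
  -- extension `M`.
  let S : Set (Submodule ℂ E) :=
    {N | (∀ C ∈ 𝒜, ∀ x ∈ N, C x ∈ N) ∧ N.starProjection ∈ 𝒜 ∧
      ∃ s : Set E, (∀ v ∈ s, ∀ w ∈ s, inner ℂ v w = if v = w then (1 : ℂ) else 0) ∧
        (∀ v ∈ s, rankOne ℂ v v ∈ 𝒜) ∧ Submodule.span ℂ s = N}
  have hS : S.Nonempty := ⟨⊥, fun C _ x hx => by
    rw [(Submodule.mem_bot ℂ).1 hx, map_zero]; exact zero_mem _, by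
    rw [Submodule.starProjection_bot]; exact zero_mem _, ∅, fun _ hv => hv.elim, fun _ hv => hv.elim,
    Submodule.span_empty⟩
  obtain ⟨N, ⟨hN, hP, s, hs, hs𝒜, hsN⟩, hmax⟩ :=
    (wellFounded_gt (α := Submodule ℂ E)).has_min S hS
  have htop : N = ⊤ := by
    by_contra hne
    obtain ⟨M, hMN, hM0, hinv, hM⟩ := exists_invariant_extension h𝒜 hN hP hne
    let e := stdOrthonormalBasis ℂ M
    have he (i) : rankOne ℂ (e i : E) (e i : E) ∈ 𝒜 := hM _ (e i).2 (e.orthonormal.1 i)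
    refine hmax (N ⊔ M) ⟨hinv, ?_, s ∪ Set.range fun i => (e i : E), ?_, ?_, ?_⟩ ?_
    · rw [starProjection_sup_of_le_orthogonal hMN, e.starProjection_eq_sum_rankOne]
      exact add_mem hP (sum_mem fun i _ => he i)
    · have hst (v) (hv : v ∈ s) (i) : inner ℂ v (e i : E) = 0 :=
        Submodule.inner_right_of_mem_orthogonal (hsN ▸ Submodule.subset_span hv) (hMN (e i).2)
      have hne' (v) (hv : v ∈ s) (i) : v ≠ (e i : E) := by
        rintro rfl
        have := hst _ hv i
        rw [inner_self_eq_zero] at this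
        exact e.orthonormal.ne_zero i (Subtype.ext this)
      rintro v (hv | ⟨i, rfl⟩) w (hw | ⟨j, rfl⟩)
      · exact hs v hv w hw
      · rw [hst v hv, if_neg (hne' v hv j)]
      · rw [inner_eq_zero_symm.1 (hst w hw i), if_neg (hne' w hw i).symm]
      · have := orthonormal_iff_ite.1 e.orthonormal i j
        rw [Submodule.coe_inner] at this
        rw [this]
        simp [e.toBasis.injective.eq_iff, ← OrthonormalBasis.coe_toBasis]
    · rintro v (hv | ⟨i, rfl⟩)
      exacts [hs𝒜 v hv, he i]
    · rw [Submodule.span_union, hsN]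
      congr 1
      have := congrArg (Submodule.map M.subtype) e.toBasis.span_eq
      rw [Submodule.map_span, Submodule.map_subtype_top, ← Set.range_comp] at this
      convert this using 3
      ext i
      simp
    · refine lt_of_le_of_ne le_sup_left fun h => hM0 ?_
      have hMle : M ≤ N := by rw [h]; exact le_sup_right
      exact (Submodule.orthogonal_disjoint N).mono_left hMle |>.eq_bot_of_le hMN
  have ho : Orthonormal ℂ ((↑) : s → E) := orthonormal_subtype_iff_ite.2 hs
  have : Fintype s := (ho.linearIndependent.setFinite).fintype
  let b : OrthonormalBasis s ℂ E := OrthonormalBasis.mk ho (by simp [hsN, htop])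
  refine ⟨_, b.reindex (Fintype.equivFin s), fun i => ?_⟩
  simpa [b] using hs𝒜 _ ((Fintype.equivFin s).symm i).2

end ProjectionFactorization

/-! ### Passing from positive definite contractions to projections -/

section Compactness

open scoped Matrix.Norms.L2Operator MatrixOrder ComplexOrder Topology Matrix
open Filter

variable {ι : Type*} [Fintype ι] [DecidableEq ι]

theorem isClosed_factorizable (W : Submodule ℂ (Matrix ι ι ℂ)) (R : ℝ) :
    IsClosed ((fun C : Matrix ι ι ℂ => star C * C) '' (W ∩ Metric.closedBall 0 R)) := by
  refine IsCompact.isClosed (IsCompact.image ?_ (by fun_prop))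
  exact (isCompact_closedBall (0 : Matrix ι ι ℂ) R).inter_left W.closed_of_finiteDimensional

/-- If all positive definite strict contractions factor as `C* C` with `C` in a subspace, then so do
all projections. -/
theorem exists_factorization_of_isStarProjection {W : Submodule ℂ (Matrix ι ι ℂ)}
    (hW : ∀ D : Matrix ι ι ℂ, D.PosDef → (1 - D).PosDef → ∃ C ∈ W, star C * C = D)
    {p : Matrix ι ι ℂ} (hp : IsStarProjection p) : ∃ C ∈ W, star C * C = p := by
  -- The factor `4⁻¹` keeps `1 - D t` positive definite for `t < 1`; it is undone at the end by
  -- replacing `C` with `2 C`.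
  let D : ℝ → Matrix ι ι ℂ := fun t => (4⁻¹ : ℝ) • (p + t • 1)
  have hp0 : p.PosSemidef := Matrix.nonneg_iff_posSemidef.1 hp.nonneg
  have hp1 : (1 - p).PosSemidef := Matrix.nonneg_iff_posSemidef.1 hp.one_sub.nonneg
  have h1 : (1 : Matrix ι ι ℂ).PosDef := .one
  have hD (t : ℝ) (ht : 0 < t) (ht1 : t < 1) : ∃ C ∈ W, star C * C = D t := by
    refine hW _ ((Matrix.PosDef.posSemidef_add hp0 (h1.smul ht)).smul (by norm_num)) ?_
    have : 1 - D t = (4⁻¹ : ℝ) • ((1 - p) + (3 - t) • (1 : Matrix ι ι ℂ)) := by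
      simp only [D]; module
    rw [this]
    exact (Matrix.PosDef.posSemidef_add hp1 (h1.smul (by linarith))).smul (by norm_num)
  have hlim : Tendsto D (𝓝[>] 0) (𝓝 ((4⁻¹ : ℝ) • p)) := by
    have : Continuous D := by fun_prop
    simpa [D] using (this.tendsto 0).mono_left nhdsWithin_le_nhds
  obtain ⟨C, ⟨hCW, -⟩, hC⟩ :=
    (isClosed_factorizable W (‖p‖ + ‖(1 : Matrix ι ι ℂ)‖ + 1)).mem_of_tendsto hlim <| by
    filter_upwards [Ioo_mem_nhdsGT (zero_lt_one' ℝ)] with t ht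
    obtain ⟨C, hC, hCD⟩ := hD t ht.1 ht.2
    refine ⟨C, ⟨hC, ?_⟩, hCD⟩
    rw [mem_closedBall_zero_iff]
    have h2 : ‖C‖ * ‖C‖ ≤ ‖p‖ + ‖(1 : Matrix ι ι ℂ)‖ := by
      rw [← CStarRing.norm_star_mul_self, hCD]
      calc ‖D t‖ = 4⁻¹ * ‖p + t • (1 : Matrix ι ι ℂ)‖ := by
            rw [norm_smul, Real.norm_of_nonneg (by norm_num)]
        _ ≤ 1 * ‖p + t • (1 : Matrix ι ι ℂ)‖ := by gcongr; norm_num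
        _ ≤ ‖p‖ + ‖t • (1 : Matrix ι ι ℂ)‖ := by rw [one_mul]; exact norm_add_le _ _
        _ ≤ ‖p‖ + 1 * ‖(1 : Matrix ι ι ℂ)‖ := by
          rw [norm_smul, Real.norm_of_nonneg ht.1.le]; gcongr; exact ht.2.le
        _ = _ := by rw [one_mul]
    nlinarith [norm_nonneg C]
  refine ⟨(2 : ℂ) • C, W.smul_mem _ hCW, ?_⟩
  change star C * C = _ at hC
  simp only [star_smul, smul_mul_smul_comm, hC, star_ofNat]
  norm_num [← Complex.coe_smul, smul_smul]

end Compactness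

/-! ### Kraus operators, Choi matrices and the coefficient algebra -/

section Kraus

open scoped Matrix ComplexOrder MatrixOrder Kronecker

variable {ι κ : Type*} [Fintype ι] {d₁ d₂ : ℕ}

/-- The linear map `X ↦ ∑ l, (V l)* X (V l)` with Kraus operators `V`. -/
def krausMap (V : ι → Matrix (Fin d₁) (Fin d₂) ℂ) : Mat d₁ →ₗ[ℂ] Mat d₂ :=
  ∑ l, adMap (V l)

theorem krausMap_apply (V : ι → Matrix (Fin d₁) (Fin d₂) ℂ) (X : Mat d₁) :
    krausMap V X = ∑ l, (V l)ᴴ * X * V l := by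
  simp [krausMap, adMap]

/-- The Kraus operators written as the rows of a single matrix. -/
def krausMatrix (V : ι → Matrix (Fin d₁) (Fin d₂) ℂ) : Matrix ι (Fin d₁ × Fin d₂) ℂ :=
  Matrix.of fun l p => V l p.1 p.2

/-- Linear combinations of Kraus operators. -/
def krausMix (C : Matrix κ ι ℂ) (V : ι → Matrix (Fin d₁) (Fin d₂) ℂ) (l : κ) :
    Matrix (Fin d₁) (Fin d₂) ℂ :=
  ∑ m, C l m • V m

theorem krausMatrix_krausMix (C : Matrix κ ι ℂ) (V : ι → Matrix (Fin d₁) (Fin d₂) ℂ) :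
    krausMatrix (krausMix C V) = C * krausMatrix V := by
  ext l p
  simp [krausMatrix, krausMix, Matrix.mul_apply, Matrix.sum_apply]

omit [Fintype ι] in
theorem krausMatrix_injective :
    Function.Injective (krausMatrix : (ι → Matrix (Fin d₁) (Fin d₂) ℂ) → _) := by
  intro V W h
  ext l a s
  exact congrFun (congrFun h l) (a, s)

/-- The Choi matrix of a linear map. -/
def choiMatrix (Φ : Mat d₁ →ₗ[ℂ] Mat d₂) : Matrix (Fin d₁ × Fin d₂) (Fin d₁ × Fin d₂) ℂ :=
  Matrix.of fun p q => Φ (Matrix.single p.1 q.1 1) p.2 q.2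

theorem choiMatrix_injective :
    Function.Injective (choiMatrix : (Mat d₁ →ₗ[ℂ] Mat d₂) → _) := by
  intro Φ Ψ h
  refine (Matrix.stdBasis ℂ (Fin d₁) (Fin d₁)).ext fun ⟨a, b⟩ => ?_
  rw [Matrix.stdBasis_eq_single]
  ext s t
  exact congrFun (congrFun h (a, s)) (b, t)

/-- With `choiMatrix_injective`, this reduces equality of Kraus maps to equality of Gram matrices.
-/
theorem choiMatrix_krausMap (V : ι → Matrix (Fin d₁) (Fin d₂) ℂ) :
    choiMatrix (krausMap V) = (krausMatrix V)ᴴ * krausMatrix V := by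
  ext ⟨a, s⟩ ⟨b, t⟩
  simp [choiMatrix, krausMap_apply, krausMatrix, Matrix.mul_apply, Matrix.sum_apply,
    Matrix.single_apply, ite_and]

/-- A positive semidefinite matrix factors as `Vᴴ * V` with `V` of full row rank. -/
theorem Matrix.PosSemidef.exists_fullRank_factorization {n : Type*} [Fintype n] [DecidableEq n]
    {J : Matrix n n ℂ} (hJ : J.PosSemidef) :
    ∃ (r : ℕ) (V : Matrix (Fin r) n ℂ) (Y : Matrix n (Fin r) ℂ), J = Vᴴ * V ∧ V * Y = 1 := by
  set U : Matrix n n ℂ := (hJ.1.eigenvectorUnitary : Matrix n n ℂ) with hU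
  have hUU : Uᴴ * U = 1 := Unitary.coe_star_mul_self hJ.1.eigenvectorUnitary
  set ev := hJ.1.eigenvalues with hev
  have hspec : J = U * Matrix.diagonal (fun i => (ev i : ℂ)) * Uᴴ := by
    conv_lhs => rw [hJ.1.spectral_theorem, Unitary.conjStarAlgAut_apply]
    rfl
  have hnn (i) : 0 ≤ ev i := hJ.eigenvalues_nonneg i
  have hsq (i) : (√(ev i) : ℂ) * √(ev i) = ev i := by
    rw [← Complex.ofReal_mul, Real.mul_self_sqrt (hnn i)]
  -- Keeping only the nonzero eigenvalues makes the rows of `V` independent, with an explicit right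
  -- inverse.
  let e := Fintype.equivFin {i // ev i ≠ 0}
  refine ⟨_, Matrix.of fun l a => (√(ev (e.symm l)) : ℂ) * star (U a (e.symm l)),
    Matrix.of fun a l => U a (e.symm l) * (√(ev (e.symm l)) : ℂ)⁻¹, ?_, ?_⟩
  · ext a b
    have h0 : J a b = ∑ i, U a i * ev i * star (U b i) := by
      conv_lhs => rw [hspec]
      simp [Matrix.mul_apply, Matrix.diagonal_apply]
    rw [h0, Matrix.mul_apply]
    symm
    refine Fintype.sum_of_injective (fun l => (e.symm l : n))
      (Subtype.val_injective.comp e.symm.injective) _ _ ?_ fun l => ?_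
    · intro i hi
      have : ev i = 0 := by
        by_contra h
        exact hi ⟨e ⟨i, h⟩, by simp⟩
      simp [this]
    · rw [← hsq]
      simp only [Matrix.conjTranspose_apply, Matrix.of_apply, star_mul', star_star]
      simp only [Complex.star_def, Complex.conj_ofReal]
      ring
  · ext l m
    have h1 : ∑ a, star (U a (e.symm l)) * U a (e.symm m) = if l = m then 1 else 0 := by
      have := congrFun (congrFun hUU (e.symm l)) (e.symm m)
      rw [Matrix.mul_apply] at this
      simpa [Matrix.one_apply, Subtype.val_inj] using this
    have h2 : (√(ev (e.symm l)) : ℂ) ≠ 0 := by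
      have := (e.symm l).2
      simpa [Real.sqrt_eq_zero (hnn _)] using this
    have : ∀ a, (√(ev (e.symm l)) : ℂ) * star (U a (e.symm l)) *
        (U a (e.symm m) * (√(ev (e.symm m)) : ℂ)⁻¹) =
        (√(ev (e.symm l)) : ℂ) * (√(ev (e.symm m)) : ℂ)⁻¹ *
          (star (U a (e.symm l)) * U a (e.symm m)) := fun a => by ring
    simp only [Matrix.mul_apply, Matrix.of_apply, this, ← Finset.mul_sum, h1, Matrix.one_apply]
    split_ifs with h
    · subst h; field_simp
    · simp

/-- The algebra of coefficient matrices `C` whose action on the Kraus operators is given by right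
multiplication with some matrix. -/
def krausAlgebra [DecidableEq ι] (V : ι → Matrix (Fin d₁) (Fin d₂) ℂ) :
    Subalgebra ℂ (Matrix ι ι ℂ) where
  carrier := {C | ∃ S : Mat d₂, ∀ l, krausMix C V l = V l * S}
  mul_mem' := by
    rintro C C' ⟨S, hS⟩ ⟨S', hS'⟩
    refine ⟨S * S', fun l => ?_⟩
    calc krausMix (C * C') V l = ∑ m, C l m • krausMix C' V m := by
          simp only [krausMix, Matrix.mul_apply, Finset.sum_smul, Finset.smul_sum, smul_smul]
          exact Finset.sum_comm
      _ = krausMix C V l * S' := by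
          simp only [hS']
          simp only [krausMix, Matrix.sum_mul, Matrix.smul_mul]
      _ = V l * (S * S') := by rw [hS, Matrix.mul_assoc]
  add_mem' := by
    rintro C C' ⟨S, hS⟩ ⟨S', hS'⟩
    refine ⟨S + S', fun l => ?_⟩
    rw [Matrix.mul_add, ← hS, ← hS']
    simp [krausMix, add_smul, Finset.sum_add_distrib]
  algebraMap_mem' := fun c => ⟨c • 1, fun l => by
    simp [krausMix, Matrix.algebraMap_matrix_apply, ite_smul]⟩

/-- If two families `x V` and `V S` define the same map and `V` is linearly independent, then
`V S = C V` for a coefficient matrix with `C* C = x* x`. -/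
theorem exists_mem_krausAlgebra_of_krausMap_eq [DecidableEq ι]
    {V : ι → Matrix (Fin d₁) (Fin d₂) ℂ}
    {Y : Matrix (Fin d₁ × Fin d₂) ι ℂ} (hY : krausMatrix V * Y = 1) {x : Matrix ι ι ℂ} {S : Mat d₂}
    (h : krausMap (krausMix x V) = krausMap fun l => V l * S) :
    ∃ C ∈ krausAlgebra V, Cᴴ * C = xᴴ * x := by
  set W := krausMatrix fun l => V l * S with hW
  have h1 : (x * krausMatrix V)ᴴ * (x * krausMatrix V) = Wᴴ * W := by
    rw [← krausMatrix_krausMix, ← choiMatrix_krausMap, h, choiMatrix_krausMap]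
  have hVZ : krausMatrix V * (1 - Y * krausMatrix V) = 0 := by
    rw [Matrix.mul_sub, ← Matrix.mul_assoc, hY, Matrix.mul_one, Matrix.one_mul, sub_self]
  -- Equal Gram matrices force equal kernels, so `W = (W * Y) * krausMatrix V`, and `W * Y` is the
  -- required `C`.
  have hWZ : W * (1 - Y * krausMatrix V) = 0 := by
    rw [← Matrix.conjTranspose_mul_self_mul_eq_zero, ← h1, Matrix.mul_assoc, Matrix.mul_assoc, hVZ,
      Matrix.mul_zero, Matrix.mul_zero]
  refine ⟨W * Y, ⟨S, fun l => ?_⟩, ?_⟩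
  · refine congrFun (krausMatrix_injective (a₁ := krausMix (W * Y) V)
      (a₂ := fun l => V l * S) ?_) l
    rw [krausMatrix_krausMix, Matrix.mul_assoc, ← hW]
    rw [Matrix.mul_sub, Matrix.mul_one, sub_eq_zero] at hWZ
    exact hWZ.symm
  · have := congrArg (fun M => Yᴴ * M * Y) h1
    simp only [Matrix.conjTranspose_mul] at this ⊢
    calc Yᴴ * Wᴴ * (W * Y) = Yᴴ * (Wᴴ * W) * Y := by simp only [Matrix.mul_assoc]
      _ = (krausMatrix V * Y)ᴴ * (xᴴ * x) * (krausMatrix V * Y) := by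
        rw [← this]; simp only [Matrix.mul_assoc, Matrix.conjTranspose_mul]
      _ = xᴴ * x := by simp [hY]

end Kraus

/-! ### Complete positivity and the existence of Kraus operators -/

section CompletelyPositiveKraus

open scoped Matrix.Norms.L2Operator MatrixOrder ComplexOrder CStarAlgebra Matrix

theorem CStarAlgebra.nonneg_iff_exists_star_mul_self {A : Type*} [NonUnitalCStarAlgebra A]
    [PartialOrder A] [StarOrderedRing A] {a : A} : 0 ≤ a ↔ ∃ b, a = star b * b :=
  CStarAlgebra.nonneg_iff_eq_star_mul_self

theorem CStarMatrix.nonneg_iff_exists_star_mul_self {n : Type*} [Fintype n] {d : ℕ}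
    {M : CStarMatrix n n (Mat d)} : 0 ≤ M ↔ ∃ N : CStarMatrix n n (Mat d), M = star N * N :=
  CStarAlgebra.nonneg_iff_exists_star_mul_self

/-- Gram matrices of rectangular matrices are nonnegative. -/
theorem CStarMatrix.nonneg_of_gram {n κ ρ : Type*} [Fintype n] [Fintype κ] [Fintype ρ] {d : ℕ}
    {M : CStarMatrix n n (Mat d)} (G : κ → n → Matrix ρ (Fin d) ℂ)
    (hM : ∀ a b, M a b = ∑ c, (G c a)ᴴ * G c b) : 0 ≤ M := by
  classical
  rcases isEmpty_or_nonempty n with hn | ⟨⟨a₀⟩⟩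
  · exact le_of_eq (CStarMatrix.ext fun a => hn.elim a)
  obtain rfl | hd := Nat.eq_zero_or_pos d
  · exact le_of_eq (CStarMatrix.ext fun a b => Subsingleton.elim _ _)
  let s₀ : Fin d := ⟨0, hd⟩
  -- Row `r` of `G c` is placed in a single row of a square block matrix that is zero elsewhere, so
  -- the rectangular Gram matrix becomes a sum of terms `star B * B`.
  let B (c : κ) (r : ρ) : CStarMatrix n n (Mat d) := CStarMatrix.ofMatrix <|
    Matrix.of fun a b => if a = a₀ then Matrix.of fun s t => if s = s₀ then G c b r t else 0 else 0
  have : M = ∑ c, ∑ r, star (B c r) * B c r := by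
    let ev (a b : n) (s t : Fin d) : CStarMatrix n n (Mat d) →+ ℂ :=
      { toFun := fun N => N a b s t, map_zero' := rfl, map_add' := fun _ _ => rfl }
    refine CStarMatrix.ext fun a b => Matrix.ext fun s t => ?_
    have hsum : ev a b s t (∑ c, ∑ r, star (B c r) * B c r) =
        ∑ c, ∑ r, ev a b s t (star (B c r) * B c r) := by simp only [map_sum]
    refine Eq.trans ?_ hsum.symm
    change _ = ∑ c, ∑ r, (star (B c r) * B c r) a b s t
    rw [hM, Matrix.sum_apply]
    refine Finset.sum_congr rfl fun c _ => ?_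
    rw [Matrix.mul_apply]
    refine Finset.sum_congr rfl fun r _ => ?_
    rw [CStarMatrix.mul_apply, Finset.sum_eq_single a₀ _ (by simp), Matrix.mul_apply,
      Finset.sum_eq_single s₀ _ (by simp)]
    · simp [B, CStarMatrix.star_apply, Matrix.star_apply]
    · intro s' _ hs'
      simp [B, hs']
    · intro a' _ ha'
      simp [B, ha']
  rw [this]
  exact Finset.sum_nonneg fun c _ => Finset.sum_nonneg fun r _ => star_mul_self_nonneg _

variable {ι : Type*} [Fintype ι] {d₁ d₂ : ℕ}

theorem isCompletelyPositive_krausMap (V : ι → Matrix (Fin d₁) (Fin d₂) ℂ) :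
    IsCompletelyPositive (krausMap V) := by
  refine ⟨⟨krausMap V, fun k M hM => ?_⟩, rfl⟩
  obtain ⟨N, rfl⟩ := CStarMatrix.nonneg_iff_exists_star_mul_self.1 hM
  refine CStarMatrix.nonneg_of_gram (κ := ι × Fin k) (fun c a => N c.2 a * V c.1) fun a b => ?_
  rw [CStarMatrix.map_apply, krausMap_apply, CStarMatrix.mul_apply, Fintype.sum_prod_type]
  refine Finset.sum_congr rfl fun i _ => ?_
  rw [Matrix.mul_sum, Matrix.sum_mul]
  refine Finset.sum_congr rfl fun c _ => ?_
  rw [CStarMatrix.star_apply, Matrix.conjTranspose_mul, Matrix.star_eq_conjTranspose]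
  simp only [Matrix.mul_assoc]

/-- The block matrix of matrix units is a Gram matrix, hence nonnegative; the Choi matrix is its
image under the ampliation. -/
theorem IsCompletelyPositive.posSemidef_choiMatrix {Φ : Mat d₁ →ₗ[ℂ] Mat d₂}
    (hΦ : IsCompletelyPositive Φ) : (choiMatrix Φ).PosSemidef := by
  obtain ⟨Θ, rfl⟩ := hΦ
  let M : CStarMatrix (Fin d₁) (Fin d₁) (Mat d₁) :=
    CStarMatrix.ofMatrix (Matrix.of fun a b => Matrix.single a b 1)
  have hM : 0 ≤ M := by
    refine CStarMatrix.nonneg_of_gram (κ := Unit) (ρ := Unit)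
      (fun _ a => Matrix.single () a 1) fun a b => ?_
    simp [M]
  obtain ⟨N, hN⟩ := CStarMatrix.nonneg_iff_exists_star_mul_self.1 (Θ.map_cstarMatrix_nonneg M hM)
  have hN' (a b) : Θ (Matrix.single a b 1) = ∑ c, (N c a)ᴴ * N c b := by
    have := congrArg (fun T : CStarMatrix (Fin d₁) (Fin d₁) (Mat d₂) => T a b) hN
    simp only [CStarMatrix.mul_apply, CStarMatrix.star_apply, CStarMatrix.map_apply] at this
    exact this
  have : choiMatrix Θ.toLinearMap =
      (Matrix.of fun (c : Fin d₁ × Fin d₂) (p : Fin d₁ × Fin d₂) => N c.1 p.1 c.2 p.2)ᴴ *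
        (Matrix.of fun (c : Fin d₁ × Fin d₂) (p : Fin d₁ × Fin d₂) => N c.1 p.1 c.2 p.2) := by
    ext ⟨a, s⟩ ⟨b, t⟩
    change Θ (Matrix.single a b 1) s t = _
    simp [hN', Matrix.mul_apply, Matrix.sum_apply, Fintype.sum_prod_type]
  rw [this]
  exact Matrix.posSemidef_conjTranspose_mul_self _

/-- A completely positive map has a linearly independent family of Kraus operators. -/
theorem IsCompletelyPositive.exists_krausMap {Φ : Mat d₁ →ₗ[ℂ] Mat d₂}
    (hΦ : IsCompletelyPositive Φ) :
    ∃ (k : ℕ) (V : Fin k → Matrix (Fin d₁) (Fin d₂) ℂ) (Y : Matrix (Fin d₁ × Fin d₂) (Fin k) ℂ),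
      Φ = krausMap V ∧ krausMatrix V * Y = 1 := by
  obtain ⟨k, V, Y, hV, hY⟩ := hΦ.posSemidef_choiMatrix.exists_fullRank_factorization
  refine ⟨k, fun l => Matrix.of fun a s => V l (a, s), Y, choiMatrix_injective ?_, hY⟩
  rw [hV, choiMatrix_krausMap]
  rfl

end CompletelyPositiveKraus

/-! ### From C⋆-extremality to orthogonal Kraus operators and degradability -/

section ExtremePoints

open scoped Matrix ComplexOrder MatrixOrder

variable {ι : Type*} [Fintype ι] [DecidableEq ι] {d₁ d₂ : ℕ}

omit [DecidableEq ι] in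
theorem krausMix_krausMix {κ μ : Type*} [Fintype κ] (C : Matrix μ κ ℂ) (C' : Matrix κ ι ℂ)
    (V : ι → Matrix (Fin d₁) (Fin d₂) ℂ) :
    krausMix C (krausMix C' V) = krausMix (C * C') V :=
  krausMatrix_injective <| by simp only [krausMatrix_krausMix, Matrix.mul_assoc]

theorem krausMix_one (V : ι → Matrix (Fin d₁) (Fin d₂) ℂ) : krausMix 1 V = V :=
  krausMatrix_injective <| by rw [krausMatrix_krausMix, Matrix.one_mul]

theorem krausMap_krausMix_of_conjTranspose_mul_self {κ : Type*} [Fintype κ] {B : Matrix κ ι ℂ}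
    (hB : Bᴴ * B = 1) (V : ι → Matrix (Fin d₁) (Fin d₂) ℂ) :
    krausMap (krausMix B V) = krausMap V := by
  apply choiMatrix_injective
  rw [choiMatrix_krausMap, choiMatrix_krausMap, krausMatrix_krausMix,
    Matrix.conjTranspose_mul, Matrix.mul_assoc, ← Matrix.mul_assoc Bᴴ, hB, Matrix.one_mul]

-- Stacking the `V l` into one tall matrix `B` gives `B* B`, and the hypothesis says that `B` is
-- injective.
omit [DecidableEq ι] in
theorem krausMap_one_posDef {V : ι → Matrix (Fin d₁) (Fin d₂) ℂ}
    (hV : ∀ v : Fin d₂ → ℂ, (∀ l, V l *ᵥ v = 0) → v = 0) : (krausMap V 1).PosDef := by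
  let B : Matrix (ι × Fin d₁) (Fin d₂) ℂ := Matrix.of fun p s => V p.1 p.2 s
  have hB : krausMap V 1 = Bᴴ * B := by
    ext s t
    simp [krausMap_apply, B, Matrix.sum_apply, Matrix.mul_apply, Fintype.sum_prod_type]
  rw [hB]
  refine Matrix.PosDef.conjTranspose_mul_self B ?_
  rw [← Matrix.coe_mulVecLin, ← LinearMap.ker_eq_bot, LinearMap.ker_eq_bot']
  intro v hv
  refine hV v fun l => ?_
  ext r
  exact congrFun hv (l, r)

/-- Mixing the Kraus operators of a unital map by `x` and normalizing yields a unital completely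
positive map. -/
theorem exists_mem_UCP_of_isUnit {V : ι → Matrix (Fin d₁) (Fin d₂) ℂ} (hV : krausMap V 1 = 1)
    {x : Matrix ι ι ℂ} (hx : IsUnit x) :
    ∃ T : Mat d₂, IsUnit T ∧ Tᴴ * T = krausMap (krausMix x V) 1 ∧
      ∃ Ψ ∈ UCP d₁ d₂, krausMap (krausMix x V) = adMap T ∘ₗ Ψ := by
  have hpos : (krausMap (krausMix x V) 1).PosDef := by
    refine krausMap_one_posDef fun v hv => ?_
    have hVv (l) : V l *ᵥ v = 0 := by
      have h1 : krausMix x⁻¹ (krausMix x V) = V := by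
        rw [krausMix_krausMix, Matrix.nonsing_inv_mul _ ((Matrix.isUnit_iff_isUnit_det _).1 hx),
          krausMix_one]
      rw [← h1, krausMix, Matrix.sum_mulVec]
      simp [Matrix.smul_mulVec, hv]
    have : krausMap V 1 *ᵥ v = 0 := by
      simp [krausMap_apply, Matrix.sum_mulVec, ← Matrix.mulVec_mulVec, hVv]
    simpa [hV] using this
  obtain ⟨T, hT⟩ := CStarAlgebra.nonneg_iff_eq_star_mul_self.mp hpos.posSemidef.nonneg
  rw [Matrix.star_eq_conjTranspose] at hT
  have hTu : IsUnit T := by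
    have := hpos.isUnit
    rw [hT, Matrix.isUnit_iff_isUnit_det, Matrix.det_mul, IsUnit.mul_iff] at this
    exact (Matrix.isUnit_iff_isUnit_det _).2 this.2
  have hTd := (Matrix.isUnit_iff_isUnit_det _).1 hTu
  have hTT : T⁻¹ * T = 1 := Matrix.nonsing_inv_mul _ hTd
  have hTT' : T * T⁻¹ = 1 := Matrix.mul_nonsing_inv _ hTd
  have key (X : Mat d₁) : krausMap (fun l => krausMix x V l * T⁻¹) X =
      (T⁻¹)ᴴ * krausMap (krausMix x V) X * T⁻¹ := by
    simp only [krausMap_apply, Matrix.mul_sum, Matrix.sum_mul, Matrix.conjTranspose_mul,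
      Matrix.mul_assoc]
  refine ⟨T, hTu, hT.symm, krausMap fun l => krausMix x V l * T⁻¹,
    ⟨isCompletelyPositive_krausMap _, ?_⟩, ?_⟩
  · rw [key, hT, ← Matrix.mul_assoc, ← Matrix.conjTranspose_mul, Matrix.mul_assoc, hTT',
      Matrix.conjTranspose_one, Matrix.one_mul]
  · ext1 X
    change _ = Tᴴ * _ * T
    rw [key]
    calc krausMap (krausMix x V) X = (T⁻¹ * T)ᴴ * krausMap (krausMix x V) X * (T⁻¹ * T) := by
          rw [hTT, Matrix.conjTranspose_one, Matrix.one_mul, Matrix.mul_one]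
      _ = _ := by simp only [Matrix.conjTranspose_mul, Matrix.mul_assoc]

/-- For a C⋆-extreme point, every positive definite strict contraction factors through the algebra
of coefficient matrices. -/
theorem exists_mem_krausAlgebra_factorization {V : ι → Matrix (Fin d₁) (Fin d₂) ℂ}
    {Y : Matrix (Fin d₁ × Fin d₂) ι ℂ} (hY : krausMatrix V * Y = 1)
    (hV : IsCStarExtremePoint (UCP d₁ d₂) (krausMap V)) {D : Matrix ι ι ℂ} (hD : D.PosDef)
    (hD' : (1 - D).PosDef) : ∃ C ∈ krausAlgebra V, star C * C = D := by
  obtain ⟨⟨-, hV1⟩, hext⟩ := hV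
  have hfac {A : Matrix ι ι ℂ} (hA : A.PosDef) : ∃ x, IsUnit x ∧ xᴴ * x = A := by
    obtain ⟨x, rfl⟩ := CStarAlgebra.nonneg_iff_eq_star_mul_self.mp hA.posSemidef.nonneg
    have := hA.isUnit
    rw [Matrix.isUnit_iff_isUnit_det, Matrix.det_mul, IsUnit.mul_iff] at this
    exact ⟨x, (Matrix.isUnit_iff_isUnit_det _).2 this.2, rfl⟩
  obtain ⟨x, hx, hxD⟩ := hfac hD
  obtain ⟨y, hy, hyD⟩ := hfac hD'
  obtain ⟨T₁, hT₁, hT₁1, Ψ₁, hΨ₁, h₁⟩ := exists_mem_UCP_of_isUnit hV1 hx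
  obtain ⟨T₂, hT₂, hT₂1, Ψ₂, hΨ₂, h₂⟩ := exists_mem_UCP_of_isUnit hV1 hy
  have hsum : krausMap V = krausMap (krausMix x V) + krausMap (krausMix y V) := by
    apply choiMatrix_injective
    change _ = choiMatrix (krausMap (krausMix x V)) + choiMatrix (krausMap (krausMix y V))
    simp only [choiMatrix_krausMap, krausMatrix_krausMix]
    calc (krausMatrix V)ᴴ * krausMatrix V
        = (krausMatrix V)ᴴ * (xᴴ * x + yᴴ * y) * krausMatrix V := by
          rw [hxD, hyD, add_sub_cancel, Matrix.mul_one]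
      _ = _ := by
        simp only [Matrix.mul_add, Matrix.add_mul, Matrix.conjTranspose_mul, Matrix.mul_assoc]
  obtain ⟨U, -, hU⟩ := hext 2 ![T₁, T₂] ![Ψ₁, Ψ₂]
    (fun i => by fin_cases i <;> assumption)
    (by rw [Fin.sum_univ_two]
        change T₁ᴴ * T₁ + T₂ᴴ * T₂ = 1
        rw [hT₁1, hT₂1, ← LinearMap.add_apply, ← hsum, hV1])
    (fun i => by fin_cases i <;> assumption)
    (by rw [Fin.sum_univ_two, hsum, h₁, h₂]; rfl) 0
  change Ψ₁ = _ at hU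
  -- The unitary and the normalizer `T₁` combine into one right multiplier `S = U * T₁`.
  have heq : krausMap (krausMix x V) = krausMap fun l => V l * (U * T₁) := by
    rw [h₁, hU]
    ext1 X
    change T₁ᴴ * (Uᴴ * krausMap V X * U) * T₁ = _
    simp only [krausMap_apply, Matrix.mul_sum, Matrix.sum_mul, Matrix.conjTranspose_mul,
      Matrix.mul_assoc]
  obtain ⟨C, hC, hCx⟩ := exists_mem_krausAlgebra_of_krausMap_eq hY heq
  exact ⟨C, hC, hCx.trans hxD⟩

/-- If the coefficient algebra contains the diagonal operators of an orthonormal basis, then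
expanding the Kraus operators in this basis makes their ranges orthogonal. -/
theorem krausMix_orthogonal_of_rankOne_mem {V : ι → Matrix (Fin d₁) (Fin d₂) ℂ}
    (hV : krausMap V 1 = 1) {n : ℕ} {B : Matrix (Fin n) ι ℂ} (hB : Bᴴ * B = 1)
    (hB' : B * Bᴴ = 1) {i : Fin n} (hi : Matrix.vecMulVec (star (B i)) (B i) ∈ krausAlgebra V)
    {j : Fin n} (hij : j ≠ i) : krausMix B V j * (krausMix B V i)ᴴ = 0 := by
  obtain ⟨S, hS⟩ := hi
  set W := krausMix B V with hW
  have hS' (l) : star (B i l) • W i = V l * S := by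
    rw [← hS, hW]
    simp [krausMix, Matrix.vecMulVec_apply, Finset.smul_sum, smul_smul]
  have hWS (j) : W j * S = (if j = i then (1 : ℂ) else 0) • W i := by
    calc W j * S = ∑ l, B j l • (V l * S) := by simp [hW, krausMix, Matrix.sum_mul]
      _ = (∑ l, B j l * star (B i l)) • W i := by simp [← hS', smul_smul, Finset.sum_smul]
      _ = _ := by
        have := congrFun (congrFun hB' j) i
        rw [Matrix.mul_apply, Matrix.one_apply] at this
        rw [← this]; rfl
  have hW1 : krausMap W 1 = 1 := by
    rw [hW, krausMap_krausMix_of_conjTranspose_mul_self hB, hV]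
  -- Inserting `1 = ∑ (W j)* W j` to the left of `S` leaves only the term `j = i`.
  have hSW : S = (W i)ᴴ * W i := by
    have : S = ∑ j, (W j)ᴴ * (W j * S) := by
      conv_lhs => rw [← Matrix.one_mul S, ← hW1]
      simp only [krausMap_apply, Matrix.mul_one, Matrix.sum_mul, Matrix.mul_assoc]
    rw [this, Finset.sum_eq_single i _ (by simp)]
    · rw [hWS, if_pos rfl, one_smul]
    · intro j _ hj
      rw [hWS, if_neg hj, zero_smul, Matrix.mul_zero]
  have h0 := hWS j
  rw [if_neg hij, zero_smul, hSW, Matrix.mul_conjTranspose_mul_self_eq_zero] at h0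
  exact h0

/-- A unital map whose Kraus operators have mutually orthogonal ranges is degradable. -/
theorem isDegradable_krausMap {k : ℕ} {V : Fin k → Matrix (Fin d₁) (Fin d₂) ℂ}
    (hV : krausMap V 1 = 1) (hort : ∀ i j, i ≠ j → V i * (V j)ᴴ = 0) :
    IsDegradable (krausMap V) := by
  have hself (i) : V i * ((V i)ᴴ * V i) = V i := by
    have : V i = ∑ j, V i * ((V j)ᴴ * V j) := by
      conv_lhs => rw [← Matrix.mul_one (V i), ← hV]
      simp only [krausMap_apply, Matrix.mul_one, Matrix.mul_sum]
    rw [Finset.sum_eq_single i _ (by simp)] at this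
    · exact this.symm
    · intro j _ hj
      rw [← Matrix.mul_assoc, hort i j hj.symm, Matrix.zero_mul]
  have hcut (i) (T : Mat d₁) : ((V i)ᴴ * V i)ᴴ * krausMap V T * ((V i)ᴴ * V i) =
      (V i)ᴴ * T * V i := by
    have hl (l) : V l * ((V i)ᴴ * V i) = if l = i then V i else 0 := by
      split_ifs with h
      · rw [h, hself]
      · rw [← Matrix.mul_assoc, hort l i h, Matrix.zero_mul]
    calc _ = ∑ l, (V l * ((V i)ᴴ * V i))ᴴ * T * (V l * ((V i)ᴴ * V i)) := by
          simp only [krausMap_apply, Matrix.mul_sum, Matrix.sum_mul, Matrix.conjTranspose_mul,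
            Matrix.conjTranspose_conjTranspose, Matrix.mul_assoc]
      _ = _ := by simp [hl, apply_ite]
  -- Kraus operators of `Γ(X) = ∑ i, tr(P i X P i) E i i`, where `P i = (V i)* V i` and `E i i` is a
  -- diagonal matrix unit.
  let G : Fin k × Fin d₂ → Matrix (Fin d₂) (Fin k) ℂ :=
    fun p => (V p.1)ᴴ * V p.1 * Matrix.single p.2 p.1 (1 : ℂ)
  let A : Matrix (Fin d₂ × Fin k) (Fin d₁) ℂ := Matrix.of fun p a => star (V p.2 a p.1)
  have hA (T : Mat d₁) (p q) : (A * T * Aᴴ) p q = ((V p.2)ᴴ * T * V q.2) p.1 q.1 := by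
    simp [A, Matrix.mul_apply]
  have hG (T : Mat d₁) (l m) : krausMap G (krausMap V T) l m =
      if l = m then ((V l)ᴴ * T * V l).trace else 0 := by
    have (p : Fin k × Fin d₂) : (G p)ᴴ * krausMap V T * G p =
        Matrix.single p.1 p.1 (((V p.1)ᴴ * T * V p.1) p.2 p.2) := by
      calc _ = Matrix.single p.1 p.2 (1 : ℂ) *
            (((V p.1)ᴴ * V p.1)ᴴ * krausMap V T * ((V p.1)ᴴ * V p.1)) *
            Matrix.single p.2 p.1 (1 : ℂ) := by
            simp only [G, Matrix.conjTranspose_mul, Matrix.mul_assoc, Matrix.conjTranspose_single,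
              star_one]
        _ = _ := by
          rw [hcut, Matrix.single_mul_mul_single, one_mul, mul_one]
    rw [krausMap_apply]
    simp only [this, Matrix.sum_apply, Fintype.sum_prod_type, Matrix.single_apply, Matrix.trace,
      Matrix.diag]
    split_ifs with h
    · subst h; simp
    · refine Finset.sum_eq_zero fun i _ => Finset.sum_eq_zero fun t _ => if_neg ?_
      rintro ⟨rfl, rfl⟩
      exact h rfl
  refine ⟨k, krausMap G, isCompletelyPositive_krausMap G, A, fun T => ⟨?_, ?_⟩⟩
  · ext i j
    simp only [partialTraceSnd, Matrix.of_apply, hA, krausMap_apply, Matrix.sum_apply]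
  · ext l m
    change krausMap G (krausMap V T) l m = _
    simp only [partialTraceFst, Matrix.of_apply, hA, hG]
    split_ifs with h
    · rw [h]; rfl
    · change 0 = ((V l)ᴴ * T * V m).trace
      rw [Matrix.trace_mul_cycle, hort m l (Ne.symm h), Matrix.zero_mul, Matrix.trace_zero]

theorem IsCStarExtremePoint.isDegradable {Φ : Mat d₁ →ₗ[ℂ] Mat d₂}
    (hΦ : IsCStarExtremePoint (UCP d₁ d₂) Φ) : IsDegradable Φ := by
  obtain ⟨k, V, Y, rfl, hY⟩ := hΦ.1.1.exists_krausMap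
  have hV1 := hΦ.1.2
  let τ := Matrix.toEuclideanCLM (n := Fin k) (𝕜 := ℂ)
  let 𝒜 : Subalgebra ℂ (EuclideanSpace ℂ (Fin k) →L[ℂ] EuclideanSpace ℂ (Fin k)) :=
    (krausAlgebra V).comap (τ.symm.toAlgEquiv : _ →ₐ[ℂ] _)
  have h𝒜 (p) (hp : IsStarProjection p) : ∃ C ∈ 𝒜, star C * C = p := by
    obtain ⟨C, hC, hCp⟩ := exists_factorization_of_isStarProjection
      (W := Subalgebra.toSubmodule (krausAlgebra V)) (p := τ.symm p)
      (fun D hD hD' => exists_mem_krausAlgebra_factorization hY hΦ hD hD') (hp.map τ.symm)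
    refine ⟨τ C, ?_, ?_⟩
    · change τ.symm (τ C) ∈ krausAlgebra V
      rwa [StarAlgEquiv.symm_apply_apply]
    · rw [← map_star, ← map_mul, hCp, StarAlgEquiv.apply_symm_apply]
  obtain ⟨n, b, hb⟩ := exists_orthonormalBasis_rankOne_mem h𝒜
  -- The rows are conjugated so that `star (B i)` times `B i` is the projection onto `b i`.
  let B : Matrix (Fin n) (Fin k) ℂ := Matrix.of fun i l => star (b i l)
  have hB' : B * Bᴴ = 1 := by
    ext i j
    have := orthonormal_iff_ite.1 b.orthonormal i j
    rw [Matrix.one_apply, ← this]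
    simp [B, Matrix.mul_apply, PiLp.inner_apply, mul_comm]
  have hn : n = k := by
    simpa using (Module.finrank_eq_card_basis b.toBasis).symm
  subst hn
  have hB : Bᴴ * B = 1 := mul_eq_one_comm.1 hB'
  have hmem (i) : Matrix.vecMulVec (star (B i)) (B i) ∈ krausAlgebra V := by
    have : τ.symm (InnerProductSpace.rankOne ℂ (b i) (b i)) ∈ krausAlgebra V := hb i
    convert this
    have hBi : star (B i) = (b i).ofLp := by ext l; simp [B]
    rw [hBi, show B i = star (b i).ofLp from rfl]
    exact (InnerProductSpace.symm_toEuclideanLin_rankOne (b i) (b i)).symm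
  have hmix := krausMap_krausMix_of_conjTranspose_mul_self hB V
  rw [← hmix]
  exact isDegradable_krausMap (hmix ▸ hV1) fun i j hij =>
    krausMix_orthogonal_of_rankOne_mem hV1 hB hB' (hmem j) hij

end ExtremePoints

theorem mainTheorem8 (d₁ d₂ : ℕ) (Φ : Mat d₁ →ₗ[ℂ] Mat d₂)
    (hΦ : IsCStarExtremePoint (UCP d₁ d₂) Φ) : IsDegradable Φ :=
  hΦ.isDegradable
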